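/- An MV-algebra is an abelian monoid $(A,0,\oplus)$ with an involutive operation $\neg$ satisfying $x\oplus\neg 0=\neg 0$ and $\neg(\neg x\oplus y)\oplus y=\neg(\neg y\oplus x)\oplus x$; its order is given by $x\le y$ iff $\neg x\oplus y=\neg 0$. An ideal of $A$ is a subset that contains $0$, is closed under $\oplus$ and is downward closed; the quotient $A/\mathfrak j$ by an ideal $\mathfrak j$ identifies $x$ and $y$ whenever $\neg(\neg x\oplus y)\oplus\neg(\neg y\oplus x)\in\mathfrak j$. A unital $\ell$-group $(G,u)$ is an abelian group $G$ with a translation invariant lattice order and an element $u\ge 0$ such that every $0\le x\in G$ satisfies $x\le nu$ for some $n\in\mathbb N$; its homomorphisms preserve the group operations, the lattice operations and the unit. An ideal of $(G,u)$ is a kernel of such a homomorphism, that is, a subgroup $\mathfrak j$ such that $|x|\le|y|$ and $y\in\mathfrak j$ imply $x\in\mathfrak j$. In both cases a maximal ideal is a maximal proper ideal, and the maximal spectral space $\mathrm{MaxSpec}$ is the set of maximal ideals with the hull-kernel topology, whose basic closed sets are $\{\mathfrak m\mid a\in\mathfrak m\}$ for $a$ in $A$ (respectively in $G$). The structure is semisimple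 if the intersection of its maximal ideals is $\{0\}$. It is hopfian if every homomorphism of it onto itself is an automorphism. A maximal ideal $\mathfrak m$ of an MV-algebra $A$ has finite rank if $A/\mathfrak m$ is finite; a maximal ideal $\mathfrak m$ of $(G,u)$ has finite rank if $G/\mathfrak m$ is isomorphic, as an $\ell$-group, to $\mathbb Z$ with its natural order, with $u/\mathfrak m$ corresponding to some integer $v>0$. (1) Every finitely generated semisimple MV-algebra $A$ whose maximal ideals of finite rank are dense in $\mathrm{MaxSpec}(A)$ is hopfian. (2) Every finitely generated semisimple unital $\ell$-group $(G,u)$ whose maximal ideals of finite rank are dense in $\mathrm{MaxSpec}(G,u)$ is hopfian. -/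

import Mathlib

universe u v

/-! MV-algebras -/

/-- An MV-algebra: an abelian monoid `(A, 0, ⊕)`, with `⊕` written `+`, and an involutive
negation `¬ x`, written `xᶜ`, such that `x ⊕ ¬0 = ¬0` and
`¬(¬x ⊕ y) ⊕ y = ¬(¬y ⊕ x) ⊕ x`. -/
class MVAlgebra (A : Type u) extends AddCommMonoid A, Compl A where
  compl_compl' : ∀ x : A, xᶜᶜ = x
  add_top' : ∀ x : A, x + (0 : A)ᶜ = (0 : A)ᶜ
  luk : ∀ x y : A, (xᶜ + y)ᶜ + y = (yᶜ + x)ᶜ + x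

namespace MVAlgebra

variable {A : Type u} [MVAlgebra A]

/-- The natural order of an MV-algebra: `x ≤ y` iff `¬x ⊕ y = 1`, where `1 = ¬0`. -/
def Le (x y : A) : Prop := xᶜ + y = (0 : A)ᶜ

/-- Truncated difference `x ⊖ y = ¬(¬x ⊕ y)`. -/
def tsub (x y : A) : A := (xᶜ + y)ᶜ

/-- Chang's distance `d(x, y) = (x ⊖ y) ⊕ (y ⊖ x)`. -/
def dist (x y : A) : A := tsub x y + tsub y x

theorem compl_add_self (x : A) : xᶜ + x = (0 : A)ᶜ := by
  have h := luk x (0 : A)ᶜ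
  rw [add_top', compl_compl', zero_add] at h
  exact h.symm

theorem tsub_add (x y : A) : tsub x y + y = tsub y x + x := luk x y

theorem le_iff_exists (x y : A) : Le x y ↔ ∃ z, y = x + z := by
  constructor
  · intro h
    refine ⟨tsub y x, ?_⟩
    have h2 := tsub_add x y
    have h3 : tsub x y = 0 := by
      unfold tsub
      rw [show xᶜ + y = (0 : A)ᶜ from h, compl_compl']
    rw [h3, zero_add] at h2
    exact h2.trans (add_comm _ _)
  · rintro ⟨z, rfl⟩
    unfold Le
    rw [← add_assoc, compl_add_self, add_comm, add_top']

theorem le_refl' (x : A) : Le x x := compl_add_self x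

theorem le_trans' {x y z : A} (h : Le x y) (k : Le y z) : Le x z := by
  rw [le_iff_exists] at *
  obtain ⟨a, rfl⟩ := h
  obtain ⟨b, rfl⟩ := k
  exact ⟨a + b, add_assoc _ _ _⟩

theorem add_le_add' {a b c d : A} (h : Le a b) (k : Le c d) : Le (a + c) (b + d) := by
  rw [le_iff_exists] at *
  obtain ⟨x, rfl⟩ := h
  obtain ⟨y, rfl⟩ := k
  exact ⟨x + y, add_add_add_comm _ _ _ _⟩

theorem tsub_le_iff (a b c : A) : Le (tsub a b) c ↔ Le a (b + c) := by
  unfold Le tsub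
  rw [compl_compl', add_assoc]

theorem le_add_tsub (x y : A) : Le x (y + tsub x y) :=
  (tsub_le_iff x y _).1 (le_refl' _)

theorem tsub_triangle (x y z : A) : Le (tsub x z) (tsub x y + tsub y z) := by
  rw [tsub_le_iff]
  have h := add_le_add' (le_add_tsub y z) (le_refl' (tsub x y))
  have e : z + (tsub x y + tsub y z) = z + tsub y z + tsub x y := by
    rw [add_assoc, add_comm (tsub x y)]
  rw [e]
  exact le_trans' (le_add_tsub x y) h

theorem tsub_add_add (x y z w : A) : Le (tsub (x + z) (y + w)) (tsub x y + tsub z w) := by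
  rw [tsub_le_iff, add_add_add_comm]
  exact add_le_add' (le_add_tsub x y) (le_add_tsub z w)

theorem tsub_self' (x : A) : tsub x x = 0 := by
  unfold tsub
  rw [compl_add_self, compl_compl']

theorem tsub_compl (x y : A) : tsub xᶜ yᶜ = tsub y x := by
  unfold tsub
  rw [compl_compl', add_comm]

end MVAlgebra

/-- An ideal of an MV-algebra: it contains `0`, is closed under `⊕` and is downward closed.
The improper ideal is allowed here; maximal ideals are proper by definition. -/
structure MVIdeal (A : Type u) [MVAlgebra A] where
  carrier : Set A
  zero_mem : (0 : A) ∈ carrier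
  add_mem : ∀ x y : A, x ∈ carrier → y ∈ carrier → x + y ∈ carrier
  mem_of_le : ∀ x y : A, MVAlgebra.Le x y → y ∈ carrier → x ∈ carrier

namespace MVIdeal

variable {A : Type u} [MVAlgebra A]

open MVAlgebra

theorem dist_mem_iff (I : MVIdeal A) (x y : A) :
    MVAlgebra.dist x y ∈ I.carrier ↔ tsub x y ∈ I.carrier ∧ tsub y x ∈ I.carrier := by
  constructor
  · intro h
    exact ⟨I.mem_of_le _ _ ((le_iff_exists _ _).2 ⟨_, rfl⟩) h,
      I.mem_of_le _ _ ((le_iff_exists _ _).2 ⟨_, add_comm _ _⟩) h⟩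
  · rintro ⟨h, k⟩
    exact I.add_mem _ _ h k

/-- The congruence of an ideal: `x ≡ y` iff `d(x, y) ∈ I`. -/
def setoid (I : MVIdeal A) : Setoid A where
  r x y := MVAlgebra.dist x y ∈ I.carrier
  iseqv :=
    { refl := fun x => by
        rw [dist_mem_iff, tsub_self']
        exact ⟨I.zero_mem, I.zero_mem⟩
      symm := fun {x y} h => by
        rw [dist_mem_iff] at h ⊢
        exact h.symm
      trans := fun {x y z} h k => by
        rw [dist_mem_iff] at h k ⊢
        exact ⟨I.mem_of_le _ _ (tsub_triangle x y z) (I.add_mem _ _ h.1 k.1),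
          I.mem_of_le _ _ (tsub_triangle z y x) (I.add_mem _ _ k.2 h.2)⟩ }

/-- The underlying set of the quotient MV-algebra `A / I`. -/
def Quot (I : MVIdeal A) : Type u := Quotient I.setoid

instance (I : MVIdeal A) : Zero I.Quot := ⟨Quotient.mk I.setoid 0⟩

instance (I : MVIdeal A) : Add I.Quot where
  add := Quotient.map₂ (· + ·) (by
    intro x y h z w k
    have h' := (dist_mem_iff I x y).1 h
    have k' := (dist_mem_iff I z w).1 k
    exact (dist_mem_iff I _ _).2
      ⟨I.mem_of_le _ _ (tsub_add_add x y z w) (I.add_mem _ _ h'.1 k'.1),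
        I.mem_of_le _ _ (tsub_add_add y x w z) (I.add_mem _ _ h'.2 k'.2)⟩)

/-- The quotient MV-algebra `A / I`, with the operations induced from `A`. -/
instance (I : MVIdeal A) : MVAlgebra I.Quot where
  compl := Quotient.map (fun x => xᶜ) (by
    intro x y h
    have h' := (dist_mem_iff I x y).1 h
    refine (dist_mem_iff I _ _).2 ?_
    rw [tsub_compl, tsub_compl]
    exact h'.symm)
  add_assoc := by
    rintro ⟨x⟩ ⟨y⟩ ⟨z⟩
    exact congrArg (Quotient.mk I.setoid) (add_assoc x y z)
  zero_add := by
    rintro ⟨x⟩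
    exact congrArg (Quotient.mk I.setoid) (zero_add x)
  add_zero := by
    rintro ⟨x⟩
    exact congrArg (Quotient.mk I.setoid) (add_zero x)
  add_comm := by
    rintro ⟨x⟩ ⟨y⟩
    exact congrArg (Quotient.mk I.setoid) (add_comm x y)
  nsmul := nsmulRec
  compl_compl' := by
    rintro ⟨x⟩
    exact congrArg (Quotient.mk I.setoid) (compl_compl' x)
  add_top' := by
    rintro ⟨x⟩
    exact congrArg (Quotient.mk I.setoid) (add_top' x)
  luk := by
    rintro ⟨x⟩ ⟨y⟩
    exact congrArg (Quotient.mk I.setoid) (luk x y)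

/-- A maximal ideal: a proper ideal that is maximal under inclusion among proper ideals. -/
def IsMaximal (m : MVIdeal A) : Prop :=
  m.carrier ≠ Set.univ ∧
    ∀ J : MVIdeal A, J.carrier ≠ Set.univ → m.carrier ⊆ J.carrier → J.carrier = m.carrier

/-- An ideal `m` has finite rank if the quotient MV-algebra `A / m` is finite. -/
def FiniteRank (m : MVIdeal A) : Prop := Finite m.Quot

end MVIdeal

/-- A homomorphism of MV-algebras. -/
structure MVHom (A : Type u) (B : Type v) [MVAlgebra A] [MVAlgebra B] where
  toFun : A → B
  map_zero : toFun 0 = 0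
  map_add : ∀ x y : A, toFun (x + y) = toFun x + toFun y
  map_compl : ∀ x : A, toFun xᶜ = (toFun x)ᶜ

namespace MVAlgebra

/-- The set of maximal ideals of `A`. -/
def MaxSpec (A : Type u) [MVAlgebra A] : Type u := {m : MVIdeal A // m.IsMaximal}

/-- The hull-kernel topology: the sets `{m | a ∈ m}`, `a ∈ A`, are a basis of closed sets;
equivalently, the closed sets are `{m | J ⊆ m}` with `J` an ideal or `A` itself. -/
instance (A : Type u) [MVAlgebra A] : TopologicalSpace (MaxSpec A) :=
  TopologicalSpace.generateFrom {U | ∃ a : A, U = {m | a ∉ m.1.carrier}}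

/-- `A` is semisimple: the intersection of its maximal ideals is `{0}`. -/
def Semisimple (A : Type u) [MVAlgebra A] : Prop :=
  (⋂ m : MaxSpec A, m.1.carrier) = {0}

/-- `B` is (the universe of) a subalgebra of `A`. -/
structure IsSubalgebra {A : Type u} [MVAlgebra A] (B : Set A) : Prop where
  zero_mem : (0 : A) ∈ B
  add_mem : ∀ x y : A, x ∈ B → y ∈ B → x + y ∈ B
  compl_mem : ∀ x : A, x ∈ B → xᶜ ∈ B

/-- `A` is finitely generated: some finite subset lies in no proper subalgebra. -/
def FinitelyGenerated (A : Type u) [MVAlgebra A] : Prop :=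
  ∃ S : Set A, S.Finite ∧ ∀ B : Set A, IsSubalgebra B → S ⊆ B → B = Set.univ

/-- `A` is hopfian: every homomorphism of `A` onto `A` is an automorphism. -/
def Hopfian (A : Type u) [MVAlgebra A] : Prop :=
  ∀ f : MVHom A A, Function.Surjective f.toFun → Function.Bijective f.toFun

end MVAlgebra

/-! Unital lattice-ordered abelian groups. An abelian group with a translation invariant lattice
order is a type with `[AddCommGroup G] [Lattice G] [IsOrderedAddMonoid G]`. -/

/-- An ideal of a lattice-ordered abelian group: a subgroup which is solid, that is, a convex
subgroup that is a sublattice. These are exactly the kernels of homomorphisms. -/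
structure LIdeal (G : Type u) [AddCommGroup G] [Lattice G] extends AddSubgroup G where
  solid : ∀ x y : G, |x| ≤ |y| → y ∈ carrier → x ∈ carrier

namespace LIdeal

variable {G : Type u} [AddCommGroup G] [Lattice G]

/-- The underlying set of the quotient `G / I`. -/
def Quot (I : LIdeal G) : Type u := G ⧸ I.toAddSubgroup

/-- The quotient map. -/
def toQuot (I : LIdeal G) (x : G) : I.Quot := QuotientAddGroup.mk (s := I.toAddSubgroup) x

instance (I : LIdeal G) : AddCommGroup I.Quot :=
  inferInstanceAs (AddCommGroup (G ⧸ I.toAddSubgroup))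

theorem toQuot_add (I : LIdeal G) (x y : G) : I.toQuot (x + y) = I.toQuot x + I.toQuot y := rfl

theorem toQuot_eq (I : LIdeal G) (x y : G) : I.toQuot x = I.toQuot y ↔ y - x ∈ I.carrier := by
  refine (QuotientAddGroup.eq (s := I.toAddSubgroup)).trans ?_
  rw [neg_add_eq_sub]
  rfl

theorem toQuot_surj (I : LIdeal G) (q : I.Quot) : ∃ x, I.toQuot x = q :=
  QuotientAddGroup.mk_surjective q

variable [IsOrderedAddMonoid G]

theorem abs_mem (I : LIdeal G) {x : G} (h : x ∈ I.carrier) : |x| ∈ I.carrier :=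
  I.solid _ _ (abs_abs x).le h

theorem sup_congr (I : LIdeal G) {x x' y y' : G} (h : I.toQuot x = I.toQuot x') (k : I.toQuot y = I.toQuot y') :
    I.toQuot (x ⊔ y) = I.toQuot (x' ⊔ y') := by
  have aux : ∀ a b c : G, I.toQuot a = I.toQuot b → I.toQuot (a ⊔ c) = I.toQuot (b ⊔ c) := by
    intro a b c hab
    rw [toQuot_eq] at *
    exact I.solid _ _ (abs_sup_sub_sup_le_abs b a c) hab
  rw [aux x x' y h, sup_comm, aux y y' x' k, sup_comm]

theorem inf_congr (I : LIdeal G) {x x' y y' : G} (h : I.toQuot x = I.toQuot x') (k : I.toQuot y = I.toQuot y') :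
    I.toQuot (x ⊓ y) = I.toQuot (x' ⊓ y') := by
  have aux : ∀ a b c : G, I.toQuot a = I.toQuot b → I.toQuot (a ⊓ c) = I.toQuot (b ⊓ c) := by
    intro a b c hab
    rw [toQuot_eq] at *
    exact I.solid _ _ (abs_inf_sub_inf_le_abs b a c) hab
  rw [aux x x' y h, inf_comm, aux y y' x' k, inf_comm]

/-- The join operation induced on `G / I`. -/
@[reducible]
def quotMax (I : LIdeal G) : Max I.Quot where
  max := Quotient.map₂ (· ⊔ ·) (by
    intro x x' h y y' k
    exact Quotient.exact (I.sup_congr (Quotient.sound h) (Quotient.sound k)))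

/-- The meet operation induced on `G / I`. -/
@[reducible]
def quotMin (I : LIdeal G) : Min I.Quot where
  min := Quotient.map₂ (· ⊓ ·) (by
    intro x x' h y y' k
    exact Quotient.exact (I.inf_congr (Quotient.sound h) (Quotient.sound k)))

/-- The quotient lattice `G / I`: joins and meets are induced from `G`, and `p ≤ q` iff
`p ⊔ q = q`. -/
instance (I : LIdeal G) : Lattice I.Quot :=
  letI := I.quotMax
  letI := I.quotMin
  Lattice.mk'
    (by
      intro p q
      obtain ⟨x, rfl⟩ := I.toQuot_surj p
      obtain ⟨y, rfl⟩ := I.toQuot_surj q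
      exact congrArg I.toQuot (sup_comm x y))
    (by
      intro p q r
      obtain ⟨x, rfl⟩ := I.toQuot_surj p
      obtain ⟨y, rfl⟩ := I.toQuot_surj q
      obtain ⟨z, rfl⟩ := I.toQuot_surj r
      exact congrArg I.toQuot (sup_assoc x y z))
    (by
      intro p q
      obtain ⟨x, rfl⟩ := I.toQuot_surj p
      obtain ⟨y, rfl⟩ := I.toQuot_surj q
      exact congrArg I.toQuot (inf_comm x y))
    (by
      intro p q r
      obtain ⟨x, rfl⟩ := I.toQuot_surj p
      obtain ⟨y, rfl⟩ := I.toQuot_surj q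
      obtain ⟨z, rfl⟩ := I.toQuot_surj r
      exact congrArg I.toQuot (inf_assoc x y z))
    (by
      intro p q
      obtain ⟨x, rfl⟩ := I.toQuot_surj p
      obtain ⟨y, rfl⟩ := I.toQuot_surj q
      exact congrArg I.toQuot (sup_inf_self (a := x) (b := y)))
    (by
      intro p q
      obtain ⟨x, rfl⟩ := I.toQuot_surj p
      obtain ⟨y, rfl⟩ := I.toQuot_surj q
      exact congrArg I.toQuot (inf_sup_self (a := x) (b := y)))

theorem toQuot_sup (I : LIdeal G) (x y : G) : I.toQuot (x ⊔ y) = I.toQuot x ⊔ I.toQuot y := rfl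

theorem toQuot_inf (I : LIdeal G) (x y : G) : I.toQuot (x ⊓ y) = I.toQuot x ⊓ I.toQuot y := rfl

instance (I : LIdeal G) : IsOrderedAddMonoid I.Quot where
  add_le_add_left := by
    intro p q h r
    obtain ⟨x, rfl⟩ := I.toQuot_surj p
    obtain ⟨y, rfl⟩ := I.toQuot_surj q
    obtain ⟨z, rfl⟩ := I.toQuot_surj r
    have h' : I.toQuot (x ⊔ y) = I.toQuot y := sup_eq_right.2 h
    refine sup_eq_right.1 ?_
    have e : I.toQuot (x + z) ⊔ I.toQuot (y + z) = I.toQuot ((x ⊔ y) + z) := by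
      rw [sup_add]
      rfl
    rw [← toQuot_add, ← toQuot_add, e, toQuot_add, h', toQuot_add]

/-- A maximal ideal: a proper ideal that is maximal under inclusion among proper ideals. -/
def IsMaximal {G : Type u} [AddCommGroup G] [Lattice G] (m : LIdeal G) : Prop :=
  m.carrier ≠ Set.univ ∧
    ∀ J : LIdeal G, J.carrier ≠ Set.univ → m.carrier ⊆ J.carrier → J.carrier = m.carrier

/-- An ideal `m` of `(G, e)` has finite rank if the quotient `G / m` is isomorphic, as a lattice
ordered group, to `ℤ` with its natural order, the unit `e / m` being sent to an integer
`k > 0`. -/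
def FiniteRank (m : LIdeal G) (e : G) : Prop :=
  ∃ (k : ℤ) (φ : m.Quot ≃+o ℤ), 0 < k ∧ φ (m.toQuot e) = k

end LIdeal

/-- `e` is a (strong, order) unit of `G`: `e ≥ 0` and every `x ≥ 0` is dominated by a multiple
of `e`. -/
def IsStrongUnit {G : Type u} [AddCommGroup G] [Lattice G] (e : G) : Prop :=
  0 ≤ e ∧ ∀ x : G, 0 ≤ x → ∃ n : ℕ, x ≤ n • e

/-- A homomorphism `(G, e) → (H, f)` of unital lattice-ordered abelian groups: it preserves the
group structure, the lattice structure and the unit. -/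
structure UnitalLHom (G : Type u) [AddCommGroup G] [Lattice G] (e : G)
    (H : Type v) [AddCommGroup H] [Lattice H] (f : H) extends G →+ H where
  map_sup : ∀ x y : G, toFun (x ⊔ y) = toFun x ⊔ toFun y
  map_inf : ∀ x y : G, toFun (x ⊓ y) = toFun x ⊓ toFun y
  map_unit : toFun e = f

namespace UnitalLGroup

/-- The set of maximal ideals of `G`. -/
def MaxSpec (G : Type u) [AddCommGroup G] [Lattice G] : Type u := {m : LIdeal G // m.IsMaximal}

/-- The hull-kernel topology: the sets `{m | a ∈ m}`, `a ∈ G`, are a basis of closed sets;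
equivalently, the closed sets are `{m | J ⊆ m}` with `J` an ideal or `G` itself. -/
instance (G : Type u) [AddCommGroup G] [Lattice G] : TopologicalSpace (MaxSpec G) :=
  TopologicalSpace.generateFrom {U | ∃ a : G, U = {m | a ∉ m.1.carrier}}

/-- `G` is semisimple: the intersection of its maximal ideals is `{0}`. -/
def Semisimple (G : Type u) [AddCommGroup G] [Lattice G] : Prop :=
  (⋂ m : MaxSpec G, m.1.carrier) = {0}

/-- `(G, e)` is finitely generated: for some finite `S`, the only sublattice subgroup of `G`
that contains `S` and the unit is `G`. -/
def FinitelyGenerated (G : Type u) [AddCommGroup G] [Lattice G] (e : G) : Prop :=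
  ∃ S : Set G, S.Finite ∧ ∀ B : AddSubgroup G,
    (∀ x y : G, x ∈ B → y ∈ B → x ⊔ y ∈ B ∧ x ⊓ y ∈ B) → e ∈ B → S ⊆ B → B = ⊤

/-- `(G, e)` is hopfian: every homomorphism of `(G, e)` onto `(G, e)` is an automorphism. -/
def Hopfian (G : Type u) [AddCommGroup G] [Lattice G] (e : G) : Prop :=
  ∀ f : UnitalLHom G e G e, Function.Surjective f.toFun → Function.Bijective f.toFun

end UnitalLGroup

/-!
A finitely generated, residually finite algebra is hopfian; both halves of the theorem are
instances of this argument of Mal'cev. Let `σ` be a homomorphism of the algebra onto itself and let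
`m` be a maximal ideal of finite rank. The homomorphisms of the algebra into its quotient by `m`
form a finite set, and precomposition with `σ` maps this set injectively, hence surjectively, to
itself. The quotient map is therefore of the form `h ∘ σ`, so it identifies any two elements that
`σ` identifies (`eq_of_finite_of_surjective`).

Finiteness holds because a homomorphism is determined by its values on the finitely many generators
(`finite_of_eqOn_finite`), and each of these values is confined to a finite set. For MV-algebras
the whole quotient is finite. For unital `ℓ`-groups the quotient is `ℤ` with unit `k`; here a
generator `s` with `|s| ≤ n • e` is sent into the interval `[-nk, nk]`, since homomorphisms preserve
the unit.

It remains to see that elements not separated by any maximal ideal of finite rank are equal. The set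
of maximal ideals containing a given element is closed, so by density an element of all maximal
ideals of finite rank lies in all maximal ideals, and by semisimplicity it is `0`.
-/

/-- A set of functions determined by their values on a finite set `S` is finite, if each point of
`S` has only finitely many possible values. -/
theorem finite_of_eqOn_finite {A B : Type*} {H : Set (A → B)} {S : Set A} (hS : S.Finite)
    (T : A → Set B) (hT : ∀ s ∈ S, (T s).Finite) (hHT : ∀ h ∈ H, ∀ s ∈ S, h s ∈ T s)
    (hdet : ∀ h ∈ H, ∀ k ∈ H, Set.EqOn h k S → h = k) : H.Finite := by
  have : Finite S := hS
  have hfin : {f : S → B | ∀ s : S, f s ∈ T s}.Finite := Set.Finite.pi' fun s => hT s s.2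
  refine Set.Finite.of_injOn (f := fun (h : A → B) (s : S) => h s)
    (t := {f : S → B | ∀ s : S, f s ∈ T s}) (fun h hh s => hHT h hh s s.2) ?_ hfin
  intro h hh k hk hhk
  exact hdet h hh k hk fun s hs => congrFun hhk ⟨s, hs⟩

/-- Mal'cev's argument: a finite set of functions that is stable under precomposition with a
surjection `σ` cannot separate points that `σ` identifies. -/
theorem eq_of_finite_of_surjective {A B : Type*} {H : Set (A → B)} (hH : H.Finite) {σ : A → A}
    (hσ : Function.Surjective σ) (hcomp : ∀ h ∈ H, h ∘ σ ∈ H) {h : A → B} (hh : h ∈ H) {x y : A}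
    (hxy : σ x = σ y) : h x = h y := by
  have himage : (fun k : A → B => k ∘ σ) '' H = H := by
    refine Set.eq_of_subset_of_ncard_le (Set.image_subset_iff.2 hcomp) ?_ hH
    exact (Set.ncard_image_of_injective H hσ.injective_comp_right).ge
  rw [← himage] at hh
  obtain ⟨k, -, rfl⟩ := hh
  exact congrArg k hxy

/-! ### MV-algebras -/

namespace MVAlgebra

variable {A : Type u} [MVAlgebra A]

theorem eq_of_dist_eq_zero {x y : A} (h : MVAlgebra.dist x y = 0) : x = y := by
  -- `0` is the least element, so both summands of the distance vanish.
  have hz : ∀ a b : A, a + b = 0 → a = 0 := by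
    intro a b hab
    have hle : Le a 0 := (le_iff_exists _ _).2 ⟨b, hab.symm⟩
    unfold Le at hle
    rw [add_zero] at hle
    rw [← compl_compl' a, hle, compl_compl']
  have hxy : tsub x y = 0 := hz _ _ h
  have hyx : tsub y x = 0 := hz _ _ ((add_comm _ _).trans h)
  have key := tsub_add x y
  rw [hxy, hyx, zero_add, zero_add] at key
  exact key.symm

theorem finite_range_toFun (hA : FinitelyGenerated A) (B : Type v) [MVAlgebra B] [Finite B] :
    (Set.range (MVHom.toFun : MVHom A B → A → B)).Finite := by
  obtain ⟨S, hS, hgen⟩ := hA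
  refine finite_of_eqOn_finite hS (fun _ => Set.univ) (fun _ _ => Set.finite_univ)
    (fun _ _ _ _ => trivial) ?_
  rintro _ ⟨φ, rfl⟩ _ ⟨ψ, rfl⟩ heq
  have huniv : {x | φ.toFun x = ψ.toFun x} = Set.univ := by
    refine hgen _ ⟨?_, ?_, ?_⟩ heq
    · exact φ.map_zero.trans ψ.map_zero.symm
    · intro x y (hx : φ.toFun x = ψ.toFun x) (hy : φ.toFun y = ψ.toFun y)
      change φ.toFun (x + y) = ψ.toFun (x + y)
      rw [φ.map_add, ψ.map_add, hx, hy]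
    · intro x (hx : φ.toFun x = ψ.toFun x)
      change φ.toFun xᶜ = ψ.toFun xᶜ
      rw [φ.map_compl, ψ.map_compl, hx]
  exact funext fun x => Set.eq_univ_iff_forall.1 huniv x

/-- The quotient map of an MV-algebra by an ideal. -/
def quotHom (I : MVIdeal A) : MVHom A I.Quot where
  toFun := Quotient.mk I.setoid
  map_zero := rfl
  map_add _ _ := rfl
  map_compl _ := rfl

theorem dist_mem_of_map_eq (hA : FinitelyGenerated A) {f : MVHom A A}
    (hf : Function.Surjective f.toFun) {m : MVIdeal A} (hm : m.FiniteRank) {x y : A}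
    (hxy : f.toFun x = f.toFun y) : MVAlgebra.dist x y ∈ m.carrier := by
  have : Finite m.Quot := hm
  have hcomp : ∀ h ∈ Set.range (MVHom.toFun : MVHom A m.Quot → A → m.Quot),
      h ∘ f.toFun ∈ Set.range (MVHom.toFun : MVHom A m.Quot → A → m.Quot) := by
    rintro _ ⟨φ, rfl⟩
    exact ⟨{ toFun := φ.toFun ∘ f.toFun
             map_zero := by simp [f.map_zero, φ.map_zero]
             map_add := by simp [f.map_add, φ.map_add]
             map_compl := by simp [f.map_compl, φ.map_compl] }, rfl⟩
  exact Quotient.exact (s := m.setoid) <|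
    eq_of_finite_of_surjective (finite_range_toFun hA m.Quot) hf hcomp ⟨quotHom m, rfl⟩ hxy

theorem eq_zero_of_forall_mem_of_dense (hss : Semisimple A) {D : Set (MaxSpec A)} (hD : Dense D)
    {a : A} (ha : ∀ m ∈ D, a ∈ m.1.carrier) : a = 0 := by
  have hopen : IsOpen {m : MaxSpec A | a ∉ m.1.carrier} :=
    TopologicalSpace.isOpen_generateFrom_of_mem ⟨a, rfl⟩
  have hmem : a ∈ ⋂ m : MaxSpec A, m.1.carrier := by
    refine Set.mem_iInter.2 fun m => ?_
    by_contra hm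
    obtain ⟨m', hm', hD'⟩ := hD.inter_open_nonempty _ hopen ⟨m, hm⟩
    exact hm' (ha m' hD')
  rw [hss] at hmem
  exact hmem

theorem hopfian_of_dense_finiteRank (hA : FinitelyGenerated A) (hss : Semisimple A)
    (hD : Dense {m : MaxSpec A | m.1.FiniteRank}) : Hopfian A := fun _ hf =>
  ⟨fun _ _ hxy => eq_of_dist_eq_zero <|
    eq_zero_of_forall_mem_of_dense hss hD fun _ hm => dist_mem_of_map_eq hA hf hm hxy, hf⟩

end MVAlgebra

/-! ### Unital lattice-ordered abelian groups -/

namespace UnitalLGroup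

variable {G : Type v} [AddCommGroup G] [Lattice G] {e : G}

theorem eq_zero_of_forall_mem_of_dense (hss : Semisimple G) {D : Set (MaxSpec G)} (hD : Dense D)
    {a : G} (ha : ∀ m ∈ D, a ∈ m.1.carrier) : a = 0 := by
  have hopen : IsOpen {m : MaxSpec G | a ∉ m.1.carrier} :=
    TopologicalSpace.isOpen_generateFrom_of_mem ⟨a, rfl⟩
  have hmem : a ∈ ⋂ m : MaxSpec G, m.1.carrier := by
    refine Set.mem_iInter.2 fun m => ?_
    by_contra hm
    obtain ⟨m', hm', hD'⟩ := hD.inter_open_nonempty _ hopen ⟨m, hm⟩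
    exact hm' (ha m' hD')
  rw [hss] at hmem
  exact hmem

theorem abs_map_le (k : ℤ) (φ : UnitalLHom G e ℤ k) {x : G} {n : ℕ} (hx : |x| ≤ n • e) :
    |φ.toFun x| ≤ n • k := by
  have hmono : φ.toFun |x| ≤ φ.toFun (n • e) := by
    rw [← sup_eq_right, ← φ.map_sup, sup_eq_right.2 hx]
  have habs : φ.toFun |x| = |φ.toFun x| := by
    change φ.toFun (x ⊔ -x) = φ.toFun x ⊔ -φ.toFun x
    rw [φ.map_sup]
    exact congrArg _ (map_neg φ.toAddMonoidHom x)
  have hunit : φ.toFun (n • e) = n • k :=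
    (map_nsmul φ.toAddMonoidHom n e).trans (congrArg (n • ·) φ.map_unit)
  rwa [habs, hunit] at hmono

variable [IsOrderedAddMonoid G]

theorem finite_range_toFun (he : IsStrongUnit e) (hG : FinitelyGenerated G e) (k : ℤ) :
    (Set.range fun φ : UnitalLHom G e ℤ k => φ.toFun).Finite := by
  obtain ⟨S, hS, hgen⟩ := hG
  choose n hn using fun x : G => he.2 |x| (abs_nonneg x)
  refine finite_of_eqOn_finite hS (fun s => Set.Icc (-(n s • k)) (n s • k))
    (fun _ _ => Set.finite_Icc _ _) ?_ ?_
  · rintro _ ⟨φ, rfl⟩ s -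
    exact abs_le.1 (abs_map_le k φ (hn s))
  · rintro _ ⟨φ, rfl⟩ _ ⟨ψ, rfl⟩ heq
    have htop : φ.toAddMonoidHom.eqLocus ψ.toAddMonoidHom = ⊤ := by
      refine hgen _ ?_ (φ.map_unit.trans ψ.map_unit.symm) heq
      intro x y (hx : φ.toFun x = ψ.toFun x) (hy : φ.toFun y = ψ.toFun y)
      constructor
      · change φ.toFun (x ⊔ y) = ψ.toFun (x ⊔ y)
        rw [φ.map_sup, ψ.map_sup, hx, hy]
      · change φ.toFun (x ⊓ y) = ψ.toFun (x ⊓ y)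
        rw [φ.map_inf, ψ.map_inf, hx, hy]
    exact funext fun x => (AddSubgroup.eq_top_iff' _).1 htop x

/-- The homomorphism to `(ℤ, k)` induced by an isomorphism of `G / m` with `ℤ` that sends the
class of the unit to `k`. -/
noncomputable def quotHomInt (m : LIdeal G) {k : ℤ} (φ : m.Quot ≃+o ℤ) (hφ : φ (m.toQuot e) = k) :
    UnitalLHom G e ℤ k where
  toFun x := φ (m.toQuot x)
  map_zero' := map_zero φ
  map_add' x y := map_add φ (m.toQuot x) (m.toQuot y)
  map_sup x y := map_sup φ (m.toQuot x) (m.toQuot y)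
  map_inf x y := map_inf φ (m.toQuot x) (m.toQuot y)
  map_unit := hφ

theorem sub_mem_of_map_eq (he : IsStrongUnit e) (hG : FinitelyGenerated G e)
    {f : UnitalLHom G e G e} (hf : Function.Surjective f.toFun) {m : LIdeal G}
    (hm : m.FiniteRank e) {x y : G} (hxy : f.toFun x = f.toFun y) : y - x ∈ m.carrier := by
  obtain ⟨k, φ, -, hφ⟩ := hm
  have hcomp : ∀ h ∈ Set.range fun ψ : UnitalLHom G e ℤ k => ψ.toFun,
      h ∘ f.toFun ∈ Set.range fun ψ : UnitalLHom G e ℤ k => ψ.toFun := by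
    rintro _ ⟨ψ, rfl⟩
    refine ⟨{ toAddMonoidHom := ψ.toAddMonoidHom.comp f.toAddMonoidHom
              map_sup := fun x y => ?_
              map_inf := fun x y => ?_
              map_unit := ?_ }, rfl⟩
    · exact (congrArg ψ.toFun (f.map_sup x y)).trans (ψ.map_sup _ _)
    · exact (congrArg ψ.toFun (f.map_inf x y)).trans (ψ.map_inf _ _)
    · exact (congrArg ψ.toFun f.map_unit).trans ψ.map_unit
  have hquot : φ (m.toQuot x) = φ (m.toQuot y) :=
    eq_of_finite_of_surjective (finite_range_toFun he hG k) hf hcomp ⟨quotHomInt m φ hφ, rfl⟩ hxy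
  exact (m.toQuot_eq x y).1 (φ.injective hquot)

theorem hopfian_of_dense_finiteRank (he : IsStrongUnit e) (hG : FinitelyGenerated G e)
    (hss : Semisimple G) (hD : Dense {m : MaxSpec G | m.1.FiniteRank e}) : Hopfian G e :=
  fun _ hf => ⟨fun _ _ hxy => (sub_eq_zero.1 <|
    eq_zero_of_forall_mem_of_dense hss hD fun _ hm => sub_mem_of_map_eq he hG hf hm hxy).symm, hf⟩

end UnitalLGroup

theorem corollary2p2 :
    (∀ (A : Type u) [MVAlgebra A], MVAlgebra.FinitelyGenerated A → MVAlgebra.Semisimple A →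
      Dense {m : MVAlgebra.MaxSpec A | m.1.FiniteRank} → MVAlgebra.Hopfian A) ∧
    (∀ (G : Type v) [AddCommGroup G] [Lattice G] [IsOrderedAddMonoid G] (e : G),
      IsStrongUnit e → UnitalLGroup.FinitelyGenerated G e → UnitalLGroup.Semisimple G →
      Dense {m : UnitalLGroup.MaxSpec G | m.1.FiniteRank e} → UnitalLGroup.Hopfian G e) :=
  ⟨fun _ _ => MVAlgebra.hopfian_of_dense_finiteRank,
    fun _ _ _ _ _ => UnitalLGroup.hopfian_of_dense_finiteRank⟩
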